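/- Let $A$ be a finite alphabet and let $\sigma\colon A^*\to A^*$ be a morphism of the free monoid, possibly erasing (some letters may be mapped to the empty word). Let $\mathcal L(\sigma)$ be the set of all factors of the words $\sigma^n(a)$, $n\ge 0$, $a\in A$, and let $\mathsf X(\sigma)\subseteq A^{\mathbb Z}$ be the substitution shift of $\sigma$, that is, the set of all two-sided infinite sequences all of whose finite factors belong to $\mathcal L(\sigma)$. For a shift space $X\subseteq A^{\mathbb Z}$ (a closed, shift-invariant set), let $\mathcal L_n(X)$ be the set of words of length $n$ that are factors of elements of $X$. A nonempty shift space is minimal if it does not properly contain a nonempty shift space, and a shift space $X$ is linearly recurrent if there is a constant $K\in\mathbb N$ such that, for every $n$, every word of $\mathcal L_n(X)$ is a factor of every word of $\mathcal L_{Kn}(X)$. If $\mathsf X(\sigma)$ is nonempty, then $\mathsf X(\sigma)$ is minimal if and only if it is linearly recurrent. -/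

import Mathlib

open SymbolicDynamics.FullShift

namespace SubstitutionShift

variable {A : Type*}

/-- The word `x_i x_{i+1} ⋯ x_{i+n-1}` read in the two-sided infinite sequence `x`. -/
def block (x : ℤ → A) (i : ℤ) (n : ℕ) : List A :=
  List.ofFn fun k : Fin n => x (i + (k : ℕ))

/-- The language of a two-sided infinite sequence: the set of its (finite) factors. -/
def seqLanguage (x : ℤ → A) : Set (List A) :=
  {w | ∃ (i : ℤ) (n : ℕ), w = block x i n}

/-- The language of an endomorphism `σ` of the free monoid on `A`, possibly erasing: the set of
all factors of the words `σ^n(a)`, for `n ≥ 0` and `a ∈ A`. -/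
def morphismLanguage (σ : FreeMonoid A →* FreeMonoid A) : Set (List A) :=
  {w | ∃ (n : ℕ) (a : A), w <:+: FreeMonoid.toList (σ^[n] (FreeMonoid.of a))}

lemma block_shift (g : ℤ) (x : ℤ → A) (i : ℤ) (n : ℕ) :
    block (shift g x) i n = block x (g + i) n := by
  simp [block, add_assoc]

variable [TopologicalSpace A]

/-- The set of the sequences all of whose factors lie in a given set of words is closed. -/
lemma isClosed_setOf_seqLanguage_subset [DiscreteTopology A] (L : Set (List A)) :
    IsClosed {x : ℤ → A | seqLanguage x ⊆ L} := by
  have h : {x : ℤ → A | seqLanguage x ⊆ L} =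
      ⋂ (i : ℤ) (n : ℕ), {x : ℤ → A | block x i n ∈ L} := by
    ext x
    simp only [Set.mem_ofPred_eq, Set.mem_iInter]
    constructor
    · intro hx i n
      exact hx ⟨i, n, rfl⟩
    · rintro hx w ⟨i, n, rfl⟩
      exact hx i n
  rw [h]
  refine isClosed_iInter fun i => isClosed_iInter fun n => ?_
  have hc : Continuous fun (x : ℤ → A) (k : Fin n) => x (i + (k : ℕ)) := by fun_prop
  exact (isClosed_discrete {f : Fin n → A | List.ofFn f ∈ L}).preimage hc

/-- The shift space `X(σ)` associated to an endomorphism `σ`: the two-sided infinite sequences all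
of whose factors are in the language of `σ`. -/
def substitutionShift [DiscreteTopology A] (σ : FreeMonoid A →* FreeMonoid A) : Subshift A ℤ where
  carrier := {x | seqLanguage x ⊆ morphismLanguage σ}
  isClosed := isClosed_setOf_seqLanguage_subset _
  mapsTo := by
    rintro g x hx w ⟨i, n, rfl⟩
    rw [block_shift]
    exact hx ⟨g + i, n, rfl⟩

/-- The language of a shift space: the set of all factors of its elements. -/
def shiftLanguage (X : Subshift A ℤ) : Set (List A) :=
  {w | ∃ x ∈ X.carrier, w ∈ seqLanguage x}

/-- A shift space is minimal if it is nonempty and does not properly contain a nonempty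
shift space. -/
def IsMinimalShift (X : Subshift A ℤ) : Prop :=
  X.carrier.Nonempty ∧
    ∀ Y : Subshift A ℤ, Y.carrier.Nonempty → Y.carrier ⊆ X.carrier → Y.carrier = X.carrier

/-- A shift space `X` is linearly recurrent if there is a constant `K` such that, for every `n`,
every word of length `n` of its language appears in every word of length `K * n` of its
language. -/
def IsLinearlyRecurrent (X : Subshift A ℤ) : Prop :=
  ∃ K : ℕ, ∀ n : ℕ, ∀ u ∈ shiftLanguage X, u.length = n →
    ∀ v ∈ shiftLanguage X, v.length = K * n → u <:+: v

end SubstitutionShift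

/-! Linear recurrence makes every word of `X` occur in any point of a subshift `Y`, so shifts of
that point approximate every point of `X` and `Y = X`.

Conversely, minimality gives uniform recurrence by compactness. Call a letter bounded if its
iterated images have bounded length. If an unbounded letter `b` occurs in `X`, the language of `X`
is stable under the morphism, and all letters of `X` have `m`-th images no longer than a constant
times that of `b`. Choosing `m` so that the image of `b` has length comparable to `n` desubstitutes
words of length `n` to words of bounded length, where uniform recurrence applies
(`isLinearlyRecurrent_of_unbounded`).

Otherwise `X` has arbitrarily long words made of bounded letters. By `exists_run_bound_or_power` the
language of the morphism then contains all powers of some `q`, so `X` contains a periodic point and,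
by minimality, consists of factors of powers of `q` (`isLinearlyRecurrent_of_power`). -/

namespace SubstitutionShift

/-! ### Factors of words and of their images under morphisms -/

/-- If `v` is a factor of `x ++ y ++ z`, then it avoids `z`, avoids `x`, or contains `y`. -/
lemma infix_append_cases {α : Type*} {v x y z : List α} (h : v <:+: x ++ y ++ z) :
    v <:+: x ++ y ∨ v <:+: y ++ z ∨ y <:+: v := by
  obtain ⟨p, r, h⟩ := h
  rcases le_or_gt x.length p.length with h1 | h1
  · right; left
    rw [List.append_assoc, List.append_assoc x] at h
    obtain ⟨t, rfl⟩ : x <+: p :=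
      List.prefix_of_prefix_length_le (l₃ := p ++ (v ++ r)) (h ▸ List.prefix_append _ _)
        (List.prefix_append _ _) h1
    exact ⟨t, r, by simpa using h⟩
  rcases le_or_gt z.length r.length with h2 | h2
  · left
    obtain ⟨t, rfl⟩ : z <:+ r :=
      List.suffix_of_suffix_length_le (l₃ := p ++ v ++ r) (h ▸ List.suffix_append _ _)
        (List.suffix_append _ _) h2
    exact ⟨p, t, by simpa [← List.append_assoc] using h⟩
  · right; right
    obtain ⟨t, rfl⟩ : p <+: x :=
      List.prefix_of_prefix_length_le (l₃ := x ++ y ++ z) (h ▸ ⟨v ++ r, by simp⟩)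
        ⟨y ++ z, by simp⟩ h1.le
    obtain ⟨t', rfl⟩ : r <:+ z :=
      List.suffix_of_suffix_length_le (l₃ := p ++ t ++ y ++ z) (h ▸ ⟨p ++ v, by simp⟩)
        ⟨p ++ t ++ y, by simp⟩ h2.le
    have h' : v ++ r = (t ++ y ++ t') ++ r := by simpa using h
    exact ⟨t, t', (List.append_cancel_right h').symm⟩

/-- If `v` is a factor of `x ++ y`, then it is a factor of `x`, a factor of `y`, or the product
of a suffix of `x` and a prefix of `y`. -/
lemma infix_append_split {α : Type*} {v x y : List α} (h : v <:+: x ++ y) :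
    v <:+: x ∨ v <:+: y ∨ ∃ a b, v = a ++ b ∧ a <:+ x ∧ b <+: y := by
  obtain ⟨p, r, h⟩ := h
  rw [List.append_assoc, List.append_eq_append_iff] at h
  rcases h with ⟨t, rfl, h⟩ | ⟨t, rfl, h⟩
  · rw [List.append_eq_append_iff] at h
    rcases h with ⟨t', rfl, rfl⟩ | ⟨t', rfl, rfl⟩
    · exact .inl ⟨p, t', by simp⟩
    · exact .inr (.inr ⟨t, t', rfl, ⟨p, rfl⟩, ⟨r, rfl⟩⟩)
  · exact .inr (.inl ⟨t, r, by simp [h]⟩)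

/-- A map between free monoids (seen as sets of lists) which is compatible with concatenation. -/
def IsConcatHom {α β : Type*} (s : List α → List β) : Prop :=
  ∀ x y, s (x ++ y) = s x ++ s y

namespace IsConcatHom

variable {α β : Type*} {s : List α → List β}

lemma map_nil (hs : IsConcatHom s) : s [] = [] := by
  have := congrArg List.length (hs [] [])
  simp only [List.append_nil, List.length_append] at this
  exact List.length_eq_zero_iff.1 (by omega)

lemma map_cons (hs : IsConcatHom s) (a : α) (w : List α) : s (a :: w) = s [a] ++ s w :=
  hs [a] w

lemma map_infix (hs : IsConcatHom s) {u v : List α} (h : u <:+: v) : s u <:+: s v := by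
  obtain ⟨p, r, rfl⟩ := h
  exact ⟨s p, s r, by rw [hs, hs]⟩

lemma map_prefix (hs : IsConcatHom s) {u v : List α} (h : u <+: v) : s u <+: s v := by
  obtain ⟨r, rfl⟩ := h
  exact ⟨s r, by rw [hs]⟩

lemma length_map_le (hs : IsConcatHom s) {M : ℕ} {w : List α}
    (h : ∀ a ∈ w, (s [a]).length ≤ M) : (s w).length ≤ w.length * M := by
  induction w with
  | nil => simp [hs.map_nil]
  | cons a w ih =>
    rw [hs.map_cons, List.length_append, List.length_cons, Nat.succ_mul]
    have := ih fun b hb => h b (by simp [hb])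
    have := h a (by simp)
    omega

lemma iterate {s : List α → List α} (hs : IsConcatHom s) (n : ℕ) : IsConcatHom s^[n] := by
  intro x y
  induction n generalizing x y with
  | zero => rfl
  | succ n ih => simp only [Function.iterate_succ_apply, hs x y, ih]

/-- A factor of an image is covered by the image of a word, which is short or whose inner part has
its image inside the given factor. -/
lemma exists_cover (hs : IsConcatHom s) {v : List β} {w : List α} (h : v <:+: s w) :
    ∃ w', w' <:+: w ∧ v <:+: s w' ∧
      (w'.length ≤ 1 ∨ ∃ c w'' d, w' = [c] ++ w'' ++ [d] ∧ s w'' <:+: v) := by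
  induction hn : w.length using Nat.strong_induction_on generalizing w with
  | _ n ih =>
  by_cases h1 : w.length ≤ 1
  · exact ⟨w, List.infix_rfl, h, .inl h1⟩
  obtain ⟨c, w'', d, rfl⟩ : ∃ c w'' d, w = [c] ++ w'' ++ [d] := by
    cases w with
    | nil => simp at h1
    | cons c w =>
      rcases List.eq_nil_or_concat w with rfl | ⟨w'', d, rfl⟩
      · simp at h1
      · exact ⟨c, w'', d, by simp⟩
  have h' := h
  rw [hs, hs] at h'
  -- An end letter whose image is not needed to cover `v` is dropped; when neither can be, `v`
  -- contains the image of the interior.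
  rcases infix_append_cases h' with h2 | h2 | h2
  · rw [← hs] at h2
    obtain ⟨w', hw, hv⟩ := ih _ (by rw [← hn]; simp) h2 rfl
    exact ⟨w', hw.trans ⟨[], [d], by simp⟩, hv⟩
  · rw [← hs] at h2
    obtain ⟨w', hw, hv⟩ := ih _ (by rw [← hn]; simp) h2 rfl
    exact ⟨w', hw.trans ⟨[c], [], by simp⟩, hv⟩
  · exact ⟨_, List.infix_rfl, h, .inr ⟨c, w'', d, rfl, h2⟩⟩

/-- A long factor of an image contains the image of a factor almost as long. -/
lemma exists_map_infix (hs : IsConcatHom s) {M : ℕ} {v : List β} {w : List α}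
    (h : v <:+: s w) (hM : ∀ a ∈ w, (s [a]).length ≤ M) :
    ∃ w'', w'' <:+: w ∧ s w'' <:+: v ∧ v.length ≤ (w''.length + 2) * M := by
  obtain ⟨w', hw', hv, h1 | ⟨c, w'', d, rfl, h2⟩⟩ := hs.exists_cover h
  · refine ⟨[], List.nil_infix, by simp [hs.map_nil], ?_⟩
    have := hs.length_map_le fun a ha => hM a (hw'.subset ha)
    have := hv.length_le
    simp only [List.length_nil]
    nlinarith
  · refine ⟨w'', .trans ⟨[c], [d], rfl⟩ hw', h2, ?_⟩
    have := hs.length_map_le fun a ha => hM a (hw'.subset ha)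
    have h3 := hv.length_le
    simp only [List.length_append, List.length_singleton] at this
    calc _ ≤ _ := h3
      _ ≤ _ := this
      _ = _ := by ring

end IsConcatHom

/-! ### Blocks, compactness and uniform recurrence -/

section Shift

variable {A : Type*}

lemma length_block (x : ℤ → A) (i : ℤ) (n : ℕ) : (block x i n).length = n := by
  simp [block]

lemma getElem_block (x : ℤ → A) (i : ℤ) (n k : ℕ) (h : k < (block x i n).length) :
    (block x i n)[k] = x (i + k) := by
  simp [block]

lemma block_add (x : ℤ → A) (i : ℤ) (m n : ℕ) :
    block x i (m + n) = block x i m ++ block x (i + m) n := by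
  refine List.ext_getElem (by simp [length_block]) fun k h1 h2 => ?_
  rw [List.getElem_append]
  split_ifs with h
  · simp [getElem_block]
  · simp only [length_block, not_lt] at h
    simp only [getElem_block, length_block]
    congr 1
    omega

lemma block_infix_block (x : ℤ → A) {i j : ℤ} {m n : ℕ} (h1 : j ≤ i) (h2 : i + m ≤ j + n) :
    block x i m <:+: block x j n := by
  obtain ⟨p, rfl⟩ := Int.le.dest h1
  obtain ⟨q, rfl⟩ : ∃ q, n = p + m + q := ⟨n - (p + m), by omega⟩
  rw [block_add, block_add]
  exact ⟨_, _, rfl⟩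

lemma exists_eq_block_of_infix {x : ℤ → A} {i : ℤ} {n : ℕ} {u : List A}
    (h : u <:+: block x i n) : ∃ j : ℤ, u = block x j u.length := by
  obtain ⟨p, r, h⟩ := h
  refine ⟨i + p.length, ?_⟩
  obtain rfl : n = p.length + u.length + r.length := by
    have := congrArg List.length h
    simpa [length_block, add_assoc] using this.symm
  rw [block_add, block_add] at h
  have h1 := List.append_inj_left' h (by simp [length_block])
  exact List.append_inj_right' h1 (by simp [length_block])

lemma block_mem_seqLanguage (x : ℤ → A) (i : ℤ) (n : ℕ) : block x i n ∈ seqLanguage x :=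
  ⟨i, n, rfl⟩

lemma mem_seqLanguage_of_infix {x : ℤ → A} {u v : List A} (h : u <:+: v)
    (hv : v ∈ seqLanguage x) : u ∈ seqLanguage x := by
  obtain ⟨i, n, rfl⟩ := hv
  obtain ⟨j, hj⟩ := exists_eq_block_of_infix h
  exact ⟨j, _, hj⟩

variable [TopologicalSpace A]

lemma mem_shiftLanguage_of_infix {X : Subshift A ℤ} {u v : List A} (h : u <:+: v)
    (hv : v ∈ shiftLanguage X) : u ∈ shiftLanguage X := by
  obtain ⟨x, hx, hv⟩ := hv
  exact ⟨x, hx, mem_seqLanguage_of_infix h hv⟩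

/-- A word of the language of a shift space can be extended on both sides. -/
lemma exists_extension_mem_shiftLanguage {X : Subshift A ℤ} {w : List A}
    (hw : w ∈ shiftLanguage X) (k : ℕ) :
    ∃ u v, u.length = k ∧ v.length = k ∧ u ++ w ++ v ∈ shiftLanguage X := by
  obtain ⟨x, hx, i, n, rfl⟩ := hw
  refine ⟨block x (i - k) k, block x (i + n) k, length_block _ _ _, length_block _ _ _, x, hx,
    i - k, k + n + k, ?_⟩
  rw [block_add, block_add]
  simp [← add_assoc]

lemma exists_mem_shiftLanguage_length {X : Subshift A ℤ} (hX : X.carrier.Nonempty) (k : ℕ) :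
    ∃ w ∈ shiftLanguage X, w.length = k := by
  obtain ⟨x, hx⟩ := hX
  exact ⟨block x 0 k, ⟨x, hx, block_mem_seqLanguage _ _ _⟩, length_block _ _ _⟩

/-- A linearly recurrent shift space is minimal. -/
lemma IsLinearlyRecurrent.isMinimalShift {X : Subshift A ℤ} (hX : IsLinearlyRecurrent X)
    (hne : X.carrier.Nonempty) : IsMinimalShift X := by
  refine ⟨hne, fun Y ⟨y, hy⟩ hYX => hYX.antisymm fun x hx => ?_⟩
  obtain ⟨K, hK⟩ := hX
  -- The central window of `x` of radius `n` occurs in `y`; shifting `y` centres that occurrence.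
  have h (n : ℕ) : ∃ z ∈ Y.carrier, ∀ i : ℤ, i.natAbs ≤ n → z i = x i := by
    have h1 := hK (2 * n + 1) (block x (-n) (2 * n + 1)) ⟨x, hx, block_mem_seqLanguage _ _ _⟩
      (length_block _ _ _) (block y 0 (K * (2 * n + 1)))
      ⟨y, hYX hy, block_mem_seqLanguage _ _ _⟩ (length_block _ _ _)
    obtain ⟨j, hj⟩ := exists_eq_block_of_infix h1
    rw [length_block] at hj
    refine ⟨shift (j + n) y, Y.mapsTo _ hy, fun i hi => ?_⟩
    have hlt : (i + n).toNat < 2 * n + 1 := by omega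
    have h2 := List.getElem_of_eq hj (i := (i + n).toNat) (by rwa [length_block])
    rw [getElem_block, getElem_block] at h2
    rw [show -(n : ℤ) + ((i + n).toNat : ℕ) = i by omega,
      show j + ((i + n).toNat : ℕ) = j + n + i by omega] at h2
    simp [h2]
  choose z hz hzx using h
  refine Y.isClosed.mem_of_tendsto (f := z) (b := Filter.atTop) ?_ (.of_forall hz)
  refine tendsto_pi_nhds.2 fun i => tendsto_const_nhds.congr' ?_
  filter_upwards [Filter.eventually_ge_atTop i.natAbs] with n hn
  exact (hzx n i hn).symm

variable [DiscreteTopology A]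

/-- König's lemma: a word which can be extended on both sides in a factorial set `F` occurs in a
two-sided infinite sequence all of whose factors are in `F`. -/
lemma exists_seqLanguage_subset [Finite A] {F : Set (List A)}
    (hF : ∀ u v, u <:+: v → v ∈ F → u ∈ F) {w : List A}
    (hw : ∀ k : ℕ, ∃ u v, k ≤ u.length ∧ k ≤ v.length ∧ u ++ w ++ v ∈ F) :
    ∃ x : ℤ → A, seqLanguage x ⊆ F ∧ w ∈ seqLanguage x := by
  let Z : ℕ → Set (ℤ → A) := fun k =>
    {x | block x (-k) (k + w.length + k) ∈ F ∧ block x 0 w.length = w}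
  have hcont (i : ℤ) (n : ℕ) (T : Set (List A)) : IsClosed {x : ℤ → A | block x i n ∈ T} := by
    have hc : Continuous fun (x : ℤ → A) (k : Fin n) => x (i + (k : ℕ)) := by fun_prop
    exact (isClosed_discrete {f : Fin n → A | List.ofFn f ∈ T}).preimage hc
  have hZc (k : ℕ) : IsClosed (Z k) := (hcont _ _ F).inter (hcont _ _ {w})
  have hanti (k l : ℕ) (h : k ≤ l) : Z l ⊆ Z k := fun x hx =>
    ⟨hF _ _ (block_infix_block x (by omega) (by push_cast; omega)) hx.1, hx.2⟩
  have hne (k : ℕ) : (Z k).Nonempty := by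
    -- Asking for `k + 1` makes `u` nonempty, so that `u[0]` can fill the positions outside the
    -- word.
    obtain ⟨u, v, hu, hv, huv⟩ := hw (k + 1)
    have hu0 : 0 < u.length := by omega
    let z : ℤ → A := fun i => (u ++ w ++ v).getD (i + u.length).toNat u[0]
    have hz : block z (-u.length) (u ++ w ++ v).length = u ++ w ++ v := by
      refine List.ext_getElem (length_block _ _ _) fun j h1 h2 => ?_
      rw [getElem_block]
      have : (-(u.length : ℤ) + j + u.length).toNat = j := by omega
      simp only [z, this]
      rw [List.getD_eq_getElem _ _ h2]
    refine ⟨z, hF _ _ ?_ huv, ?_⟩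
    · rw [← hz]
      apply block_infix_block
      · omega
      · simp only [List.length_append]; push_cast; omega
    · rw [List.length_append, List.length_append, block_add, block_add] at hz
      have h1 := List.append_inj_left' hz (by simp [length_block])
      have h2 := List.append_inj_right' h1 (by simp [length_block])
      simpa using h2
  obtain ⟨x, hx⟩ := IsCompact.nonempty_iInter_of_directed_nonempty_isCompact_isClosed Z
    (fun k l => ⟨max k l, hanti _ _ (le_max_left _ _), hanti _ _ (le_max_right _ _)⟩)
    hne (fun k => (hZc k).isCompact) hZc
  simp only [Set.mem_iInter] at hx
  refine ⟨x, ?_, 0, w.length, (hx 0).2.symm⟩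
  rintro _ ⟨i, n, rfl⟩
  refine hF _ _ (block_infix_block x ?_ ?_) (hx (i.natAbs + n)).1
  · omega
  · omega

/-- The shift space of the sequences of `X` all of whose factors are in `F`. -/
def restrictLanguage (X : Subshift A ℤ) (F : Set (List A)) : Subshift A ℤ where
  carrier := X.carrier ∩ {x | seqLanguage x ⊆ F}
  isClosed := X.isClosed.inter (isClosed_setOf_seqLanguage_subset F)
  mapsTo := by
    rintro g x ⟨hx, hF⟩
    refine ⟨X.mapsTo g hx, ?_⟩
    rintro w ⟨i, n, rfl⟩
    rw [block_shift]
    exact hF ⟨g + i, n, rfl⟩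

lemma shiftLanguage_subset_morphismLanguage {σ : FreeMonoid A →* FreeMonoid A} :
    shiftLanguage (substitutionShift σ) ⊆ morphismLanguage σ := by
  rintro w ⟨x, hx, hw⟩
  exact hx hw

/-- A minimal substitution shift is uniformly recurrent. -/
lemma IsMinimalShift.exists_recurrence [Finite A] {σ : FreeMonoid A →* FreeMonoid A}
    (hX : IsMinimalShift (substitutionShift σ)) {u : List A}
    (hu : u ∈ shiftLanguage (substitutionShift σ)) :
    ∃ R : ℕ, ∀ v ∈ shiftLanguage (substitutionShift σ), R ≤ v.length → u <:+: v := by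
  by_contra! hcon
  set X := substitutionShift σ
  let F : Set (List A) := {v | v ∈ shiftLanguage X ∧ ¬ u <:+: v}
  obtain ⟨x, hxF, -⟩ := exists_seqLanguage_subset (F := F) (w := [])
    (fun p q hpq hq => ⟨mem_shiftLanguage_of_infix hpq hq.1, fun h => hq.2 (h.trans hpq)⟩)
    (fun k => by
      obtain ⟨v, hv, hk, huv⟩ := hcon (k + k)
      refine ⟨v.take k, v.drop k, by simp; omega, by simp; omega, ?_⟩
      simpa using ⟨hv, huv⟩)
  have hxX : x ∈ X.carrier := fun w hw => shiftLanguage_subset_morphismLanguage (hxF hw).1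
  have h := hX.2 (restrictLanguage X F) ⟨x, hxX, hxF⟩ Set.inter_subset_left
  obtain ⟨y, hy, huy⟩ := hu
  rw [← h] at hy
  exact (hy.2 huy).2 List.infix_rfl

lemma IsMinimalShift.exists_uniform_recurrence [Finite A] {σ : FreeMonoid A →* FreeMonoid A}
    (hX : IsMinimalShift (substitutionShift σ)) (D : ℕ) :
    ∃ R : ℕ, ∀ u ∈ shiftLanguage (substitutionShift σ), u.length ≤ D →
      ∀ v ∈ shiftLanguage (substitutionShift σ), R ≤ v.length → u <:+: v := by
  choose! R hR using fun (u : List A) (hu : u ∈ shiftLanguage (substitutionShift σ)) =>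
    hX.exists_recurrence hu
  obtain ⟨B, hB⟩ := ((List.finite_length_le A D).image R).bddAbove
  exact ⟨B, fun u hu huD v hv hvB => hR u hu v hv ((hB ⟨u, huD, rfl⟩).trans hvB)⟩

end Shift

/-! ### Bounded letters and eventually periodic orbits -/

section Bounded

variable {A : Type*} {s : List A → List A}

lemma IsConcatHom.exists_mem_of_mem {α β : Type*} {s : List α → List β} (hs : IsConcatHom s)
    {w : List α} {b : β} (hb : b ∈ s w) : ∃ a ∈ w, b ∈ s [a] := by
  induction w with
  | nil => simp [hs.map_nil] at hb
  | cons a w ih =>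
    rw [hs.map_cons, List.mem_append] at hb
    rcases hb with hb | hb
    · exact ⟨a, by simp, hb⟩
    · obtain ⟨c, hc, hbc⟩ := ih hb
      exact ⟨c, by simp [hc], hbc⟩

/-- The letter `a` is bounded for `s` if the lengths of the words `s^n(a)` are bounded. -/
def IsBoundedLetter (s : List A → List A) (a : A) : Prop :=
  ∃ C, ∀ n, (s^[n] [a]).length ≤ C

/-- A word is bounded for `s` if all its letters are. -/
def IsBoundedWord (s : List A → List A) (w : List A) : Prop :=
  ∀ a ∈ w, IsBoundedLetter s a

lemma exists_bound_boundedLetter [Finite A] (s : List A → List A) :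
    ∃ C, ∀ a, IsBoundedLetter s a → ∀ n, (s^[n] [a]).length ≤ C := by
  choose! C hC using fun (a : A) (ha : IsBoundedLetter s a) => ha
  obtain ⟨B, hB⟩ := (Set.finite_range C).bddAbove
  exact ⟨B, fun a ha n => (hC a ha n).trans (hB ⟨a, rfl⟩)⟩

lemma IsBoundedWord.of_infix {u v : List A} (hv : IsBoundedWord s v) (h : u <:+: v) :
    IsBoundedWord s u := fun a ha => hv a (h.subset ha)

lemma IsBoundedWord.map (hs : IsConcatHom s) {w : List A} (hw : IsBoundedWord s w) :
    IsBoundedWord s (s w) := by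
  intro b hb
  obtain ⟨a, ha, hba⟩ := hs.exists_mem_of_mem hb
  obtain ⟨C, hC⟩ := hw a ha
  refine ⟨C, fun n => ?_⟩
  obtain ⟨p, r, h⟩ := List.append_of_mem hba
  have h1 : [b] <:+: s [a] := ⟨p, r, by simp [h]⟩
  exact ((hs.iterate n).map_infix h1).length_le.trans (hC (n + 1))

lemma IsBoundedWord.append {u v : List A} (hu : IsBoundedWord s u) (hv : IsBoundedWord s v) :
    IsBoundedWord s (u ++ v) := fun a ha =>
  (List.mem_append.1 ha).elim (hu a) (hv a)

lemma exists_first {P : A → Prop} {l : List A} (h : ¬ ∀ a ∈ l, P a) :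
    ∃ u d v, l = u ++ d :: v ∧ (∀ a ∈ u, P a) ∧ ¬ P d := by
  induction l with
  | nil => simp at h
  | cons a l ih =>
    by_cases ha : P a
    · obtain ⟨u, d, v, rfl, hu, hd⟩ := ih fun h' => h (by simpa [ha] using h')
      exact ⟨a :: u, d, v, rfl, by simpa [ha] using hu, hd⟩
    · exact ⟨[], a, l, rfl, by simp, ha⟩

/-- If all letters of `s [c]` were bounded, a common bound for them would bound the iterates of `c`.
-/
lemma exists_first_unbounded [Finite A] (hs : IsConcatHom s) {c : A}
    (hc : ¬ IsBoundedLetter s c) :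
    ∃ d u v, s [c] = u ++ d :: v ∧ IsBoundedWord s u ∧ ¬ IsBoundedLetter s d := by
  have h : ¬ IsBoundedWord s (s [c]) := by
    intro h
    obtain ⟨C, hC⟩ := exists_bound_boundedLetter s
    refine hc ⟨1 + (s [c]).length * C, fun n => ?_⟩
    cases n with
    | zero => simp
    | succ n =>
      have := (hs.iterate n).length_map_le fun a ha => hC a (h a ha) n
      rw [Function.iterate_succ_apply]
      omega
  obtain ⟨u, d, v, h1, h2, h3⟩ := exists_first h
  exact ⟨d, u, v, h1, h2, h3⟩

lemma IsBoundedWord.length_le_of_prefix {p u v : List A} {d : A} (hp : IsBoundedWord s p)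
    (h : p <+: u ++ d :: v) (hd : ¬ IsBoundedLetter s d) : p.length ≤ u.length := by
  by_contra! hlt
  have : u ++ [d] <+: p :=
    List.prefix_of_prefix_length_le ⟨v, by simp⟩ h (by simpa using hlt)
  exact hd (hp d (this.subset (by simp)))

lemma prefix_append_cases {p x y : List A} (h : p <+: x ++ y) :
    p <+: x ∨ ∃ t, p = x ++ t ∧ t <+: y := by
  obtain ⟨r, h⟩ := h
  rw [List.append_eq_append_iff] at h
  rcases h with ⟨t, rfl, -⟩ | ⟨t, rfl, h⟩
  · exact .inl ⟨t, rfl⟩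
  · exact .inr ⟨t, rfl, r, h.symm⟩

/-- Bounds on the lengths of the prefixes with a hereditary property add up. -/
lemma IsConcatHom.length_prefix_le {f : List A → List A} (hf : IsConcatHom f) {K : ℕ}
    {w : List A} (hK : ∀ a ∈ w, ∀ p, IsBoundedWord s p → p <+: f [a] → p.length ≤ K)
    {p : List A} (hp : IsBoundedWord s p) (h : p <+: f w) : p.length ≤ w.length * K := by
  induction w generalizing p with
  | nil => rw [hf.map_nil, List.prefix_nil] at h; simp [h]
  | cons a w ih =>
    rw [hf.map_cons] at h
    rw [List.length_cons, Nat.succ_mul]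
    rcases prefix_append_cases h with h' | ⟨t, rfl, h'⟩
    · have := hK a (by simp) p hp h'
      omega
    · have h1 := hK a (by simp) _ (hp.of_infix (List.prefix_append _ _).isInfix)
        List.prefix_rfl
      have h2 := ih (fun a ha => hK a (by simp [ha]))
        (hp.of_infix (List.suffix_append _ _).isInfix) h'
      rw [List.length_append]
      omega

/-- Finitely many points with finite orbits have a common iterate which is idempotent on them. -/
lemma exists_idempotent_iterate {ι T : Type*} [Finite ι] (f : T → T) (t : ι → T)
    (h : ∀ i, ∃ m p, 0 < p ∧ f^[m + p] (t i) = f^[m] (t i)) :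
    ∃ N, 0 < N ∧ ∀ k i, f^[N * (k + 1)] (t i) = f^[N] (t i) := by
  classical
  cases nonempty_fintype ι
  choose m p hp h using h
  have key (i : ι) (n : ℕ) (hn : m i ≤ n) (k : ℕ) : f^[n + p i * k] (t i) = f^[n] (t i) := by
    obtain ⟨q, rfl⟩ := Nat.exists_eq_add_of_le hn
    induction k with
    | zero => simp
    | succ k ih =>
      rw [show m i + q + p i * (k + 1) = (q + p i * k) + (m i + p i) by ring,
        Function.iterate_add_apply, h, ← Function.iterate_add_apply,
        show q + p i * k + m i = m i + q + p i * k by ring, ih]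
  -- A positive common multiple of the periods that is at least every preperiod.
  refine ⟨(∏ i, p i) * (1 + ∑ i, m i),
    Nat.mul_pos (Finset.prod_pos fun i _ => hp i) (by omega), fun k i => ?_⟩
  obtain ⟨q, hq⟩ := Finset.dvd_prod_of_mem p (Finset.mem_univ i)
  have hP : 0 < ∏ i, p i := Finset.prod_pos fun i _ => hp i
  have hm : m i ≤ ∑ i, m i := Finset.single_le_sum (fun _ _ => Nat.zero_le _) (Finset.mem_univ i)
  have := key i ((∏ i, p i) * (1 + ∑ i, m i)) (by nlinarith) (q * (1 + ∑ i, m i) * k)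
  rw [← this, hq]
  congr 2
  ring

/-- A point with a finite orbit is eventually periodic. -/
lemma exists_iterate_add_eq {T : Type*} {f : T → T} {t : T} {S : Set T} (hS : S.Finite)
    (h : ∀ n, f^[n] t ∈ S) : ∃ m p, 0 < p ∧ f^[m + p] t = f^[m] t := by
  obtain ⟨i, -, j, -, hij, h⟩ := Set.infinite_univ.exists_ne_map_eq_of_mapsTo
    (f := fun n => f^[n] t) (fun n _ => h n) hS
  rcases lt_or_gt_of_ne hij with hlt | hlt
  · exact ⟨i, j - i, by omega, by rw [Nat.add_sub_cancel' hlt.le]; exact h.symm⟩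
  · exact ⟨j, i - j, by omega, by rw [Nat.add_sub_cancel' hlt.le]; exact h⟩

end Bounded

/-! ### Bounded runs are short, or all powers of a word occur -/

section Dichotomy

variable {A : Type*} {s : List A → List A}

/-- Follow the first unbounded letter `lam` under iteration. For a suitable power `t` of `s`, this
letter is fixed and `t` is idempotent on bounded words. If `t [d] = l ++ d :: r` with `l` bounded,
each further application of `t` inserts a copy of `t l` on the left of `d`: either these copies are
nonempty and form powers, or they vanish and the bounded prefix stops growing. -/
lemma exists_prefix_bound_or_power [Finite A] (hs : IsConcatHom s) :
    (∃ K, ∀ n a p, IsBoundedWord s p → p <+: s^[n] [a] → p.length ≤ K) ∨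
      ∃ q : List A, q ≠ [] ∧ ∀ k, ∃ n a, (List.replicate k q).flatten <:+: s^[n] [a] := by
  rcases isEmpty_or_nonempty A with hA | hA
  · exact .inl ⟨0, fun n a => hA.elim a⟩
  obtain ⟨C, hC⟩ := exists_bound_boundedLetter s
  choose! lam u v huv hu hlam using fun (c : A) (hc : ¬ IsBoundedLetter s c) =>
    exists_first_unbounded hs hc
  have iter (n : ℕ) (c : A) (hc : ¬ IsBoundedLetter s c) : ¬ IsBoundedLetter s (lam^[n] c) ∧
      ∃ x y, s^[n] [c] = x ++ lam^[n] c :: y ∧ IsBoundedWord s x := by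
    induction n with
    | zero => exact ⟨hc, [], [], rfl, by simp [IsBoundedWord]⟩
    | succ n ih =>
      obtain ⟨h1, x, y, h2, h3⟩ := ih
      simp only [Function.iterate_succ_apply']
      refine ⟨hlam _ h1, s x ++ u (lam^[n] c), v (lam^[n] c) ++ s y, ?_,
        (h3.map hs).append (hu _ h1)⟩
      rw [h2, hs, hs.map_cons, huv _ h1]
      simp
  obtain ⟨N1, hN1, h1⟩ := exists_idempotent_iterate s
    (fun b : {b // IsBoundedLetter s b} => [b.1])
    (fun b => exists_iterate_add_eq (List.finite_length_le A C) (hC b.1 b.2))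
  obtain ⟨N2, hN2, h2⟩ := exists_idempotent_iterate lam id
    (fun b => exists_iterate_add_eq Set.finite_univ (fun _ => Set.mem_univ _))
  set N := N1 * N2 with hN
  have hN0 : 0 < N := Nat.mul_pos hN1 hN2
  set t : List A → List A := s^[N] with ht
  have hts : IsConcatHom t := hs.iterate N
  have htt (w : List A) (hw : IsBoundedWord s w) : t (t w) = t w := by
    induction w with
    | nil => simp [hts.map_nil]
    | cons a w ih =>
      have ha : t (t [a]) = t [a] := by
        have key (k : ℕ) (hk : 0 < k) : s^[N1 * k] [a] = s^[N1] [a] := by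
          obtain ⟨j, rfl⟩ := Nat.exists_eq_succ_of_ne_zero hk.ne'
          exact h1 j ⟨a, hw a (by simp)⟩
        rw [ht, ← Function.iterate_add_apply, hN, key N2 hN2, ← mul_add, key _ (by omega)]
      rw [hts.map_cons, hts, ha, ih (hw.of_infix (List.suffix_cons _ _).isInfix)]
  have hmu (c : A) : lam^[N] (lam^[N] c) = lam^[N] c := by
    have key (k : ℕ) (hk : 0 < k) : lam^[N2 * k] c = lam^[N2] c := by
      obtain ⟨j, rfl⟩ := Nat.exists_eq_succ_of_ne_zero hk.ne'
      exact h2 j c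
    rw [← Function.iterate_add_apply, hN, mul_comm N1, key N1 hN1, ← mul_add, key _ (by omega)]
  have hpow (m : ℕ) : t^[m] = s^[N * m] := (Function.iterate_mul s N m).symm
  by_cases hcase : ∃ d l r, t [d] = l ++ d :: r ∧ IsBoundedWord s l ∧ t l ≠ []
  · right
    obtain ⟨d, l, r, hd, hl, hne⟩ := hcase
    have hflat (m : ℕ) : t (List.replicate m (t l)).flatten = (List.replicate m (t l)).flatten := by
      induction m with
      | zero => simp [hts.map_nil]
      | succ m ih => rw [List.replicate_succ, List.flatten_cons, hts, ih, htt l hl]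
    have claim (m : ℕ) : ∃ r, t^[m + 1] [d] = (List.replicate m (t l)).flatten ++ l ++ d :: r := by
      induction m with
      | zero => exact ⟨r, by simpa using hd⟩
      | succ m ih =>
        obtain ⟨r', hr'⟩ := ih
        refine ⟨r ++ t r', ?_⟩
        rw [Function.iterate_succ_apply', hr', hts, hts, hts.map_cons, hflat, hd,
          List.replicate_succ', List.flatten_append]
        simp
    refine ⟨t l, hne, fun k => ⟨N * (k + 1), d, ?_⟩⟩
    obtain ⟨r', hr'⟩ := claim k
    rw [← hpow, hr', List.append_assoc]
    exact (List.prefix_append _ _).isInfix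
  · left
    push Not at hcase
    have key (a : A) : ∃ K, ∀ m p, IsBoundedWord s p → p <+: t^[m] [a] → p.length ≤ K := by
      by_cases ha : IsBoundedLetter s a
      · exact ⟨C, fun m p _ hp => hp.length_le.trans (by rw [hpow]; exact hC a ha _)⟩
      obtain ⟨hd, h, r, hr, hh⟩ := iter N a ha
      obtain ⟨-, l, r', hr', hl⟩ := iter N _ hd
      rw [hmu] at hr'
      have htl := hcase _ l r' hr' hl
      have claim (m : ℕ) : ∃ p r, t^[m] [lam^[N] a] = p ++ lam^[N] a :: r ∧ t p = [] ∧
          p.length ≤ l.length := by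
        induction m with
        | zero => exact ⟨[], [], rfl, hts.map_nil, by simp⟩
        | succ m ih =>
          obtain ⟨p, r1, h1, h2, h3⟩ := ih
          refine ⟨l, r' ++ t r1, ?_, htl, le_rfl⟩
          rw [Function.iterate_succ_apply', h1, hts, hts.map_cons, h2, ht, hr']
          simp
      -- The `1` covers `m = 0`; afterwards the bounded prefix is an iterated image of `h` followed
      -- by a word no longer than `l`.
      refine ⟨1 + (h.length * C + l.length), fun m p hp hpre => ?_⟩
      cases m with
      | zero => have := hpre.length_le; simp at this; omega
      | succ m =>
        obtain ⟨p', r1, h1, -, h3⟩ := claim m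
        have h4 : t^[m + 1] [a] = (t^[m] h ++ p') ++ lam^[N] a :: (r1 ++ t^[m] r) := by
          rw [Function.iterate_succ_apply, ht, hr, ← ht, hts.iterate m, (hts.iterate m).map_cons,
            h1]
          simp
        rw [h4] at hpre
        have h5 := hp.length_le_of_prefix hpre hd
        have h6 := (hts.iterate m).length_map_le (w := h) (M := C)
          (fun b hb => by rw [hpow]; exact hC b (hh b hb) _)
        rw [List.length_append] at h5
        omega
    choose K hK using key
    obtain ⟨K', hK'⟩ := (Set.finite_range K).bddAbove
    obtain ⟨G, hG⟩ := (Set.finite_range fun x : Fin N × A => (s^[x.1] [x.2]).length).bddAbove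
    -- The remainder of `n` modulo `N` yields a word of at most `G` letters, to each of which the
    -- bound for powers of `t` applies.
    refine ⟨G * K', fun n a p hp hpre => ?_⟩
    rw [← Nat.div_add_mod n N, Function.iterate_add_apply, ← hpow] at hpre
    have h3 := (hts.iterate (n / N)).length_prefix_le (K := K')
      (fun b _ p hp hpre => (hK b _ p hp hpre).trans (hK' ⟨b, rfl⟩)) hp hpre
    exact h3.trans (Nat.mul_le_mul_right _ (hG ⟨(⟨n % N, Nat.mod_lt _ hN0⟩, a), rfl⟩))

/-- The map obtained from `s` by reversing words. -/
def reversal (s : List A → List A) (w : List A) : List A := (s w.reverse).reverse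

lemma IsConcatHom.reversal (hs : IsConcatHom s) : IsConcatHom (reversal s) := by
  intro x y
  simp [SubstitutionShift.reversal, hs y.reverse x.reverse]

lemma reversal_iterate (s : List A → List A) (n : ℕ) :
    (reversal s)^[n] = reversal s^[n] := by
  induction n with
  | zero => ext1 w; simp [reversal]
  | succ n ih =>
    ext1 w
    rw [Function.iterate_succ_apply', ih]
    simp [reversal, Function.iterate_succ_apply']

lemma isBoundedLetter_reversal {a : A} :
    IsBoundedLetter (reversal s) a ↔ IsBoundedLetter s a := by
  simp [IsBoundedLetter, reversal_iterate, reversal]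

/-- Reversal exchanges prefixes and suffixes and preserves boundedness of letters. -/
lemma exists_suffix_bound_or_power [Finite A] (hs : IsConcatHom s) :
    (∃ K, ∀ n a p, IsBoundedWord s p → p <:+ s^[n] [a] → p.length ≤ K) ∨
      ∃ q : List A, q ≠ [] ∧ ∀ k, ∃ n a, (List.replicate k q).flatten <:+: s^[n] [a] := by
  rcases exists_prefix_bound_or_power hs.reversal with ⟨K, hK⟩ | ⟨q, hq, h⟩
  · refine .inl ⟨K, fun n a p hp hsuf => ?_⟩
    have := hK n a p.reverse (fun b hb => isBoundedLetter_reversal.2 (hp b (by simpa using hb)))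
      (by rw [reversal_iterate]; simpa [reversal] using hsuf)
    simpa using this
  · refine .inr ⟨q.reverse, by simpa using hq, fun k => ?_⟩
    obtain ⟨n, a, h⟩ := h k
    refine ⟨n, a, ?_⟩
    rw [reversal_iterate, reversal, ← List.reverse_infix] at h
    simpa [List.reverse_flatten] using h

/-- A bounded factor of an image either lies in the image of a letter, or its length is bounded
by means of the lengths of the bounded prefixes and suffixes of the images of letters. -/
lemma IsConcatHom.length_infix_le {f : List A → List A} (hf : IsConcatHom f) {K : ℕ}
    (hpre : ∀ a p, IsBoundedWord s p → p <+: f [a] → p.length ≤ K)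
    (hsuf : ∀ a p, IsBoundedWord s p → p <:+ f [a] → p.length ≤ K)
    {v w : List A} (hv : IsBoundedWord s v) (h : v <:+: f w) :
    v.length ≤ w.length * K ∨ ∃ a, v <:+: f [a] := by
  induction w with
  | nil => rw [hf.map_nil, List.infix_nil] at h; simp [h]
  | cons a w ih =>
    rw [hf.map_cons] at h
    rw [List.length_cons, Nat.succ_mul]
    rcases infix_append_split h with h | h | ⟨x, y, rfl, hx, hy⟩
    · exact .inr ⟨a, h⟩
    · rcases ih h with h | h
      · left; omega
      · exact .inr h
    · left
      have h1 := hsuf a x (hv.of_infix (List.prefix_append _ _).isInfix) hx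
      have h2 := hf.length_prefix_le (fun a _ => hpre a)
        (hv.of_infix (List.suffix_append _ _).isInfix) hy
      rw [List.length_append]
      omega

/-- Either the bounded factors of the words `s^n(a)` have bounded lengths, or some nonempty
word has all its powers among the factors of these words. -/
lemma exists_run_bound_or_power [Finite A] (hs : IsConcatHom s) :
    (∃ K, ∀ n a w, IsBoundedWord s w → w <:+: s^[n] [a] → w.length ≤ K) ∨
      ∃ q : List A, q ≠ [] ∧ ∀ k, ∃ n a, (List.replicate k q).flatten <:+: s^[n] [a] := by
  rcases exists_prefix_bound_or_power hs with ⟨K1, h1⟩ | h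
  swap
  · exact .inr h
  rcases exists_suffix_bound_or_power hs with ⟨K2, h2⟩ | h
  swap
  · exact .inr h
  left
  obtain ⟨G, hG⟩ := (Set.finite_range fun a : A => (s [a]).length).bddAbove
  refine ⟨1 + G * (K1 + K2), fun n a w hw h => ?_⟩
  induction n generalizing a with
  | zero =>
    have := h.length_le
    simp only [Function.iterate_zero, id_eq, List.length_singleton] at this
    omega
  | succ n ih =>
    rw [Function.iterate_succ_apply] at h
    -- Either `w` is short or it lies in the `n`-th image of a single letter, and the induction
    -- continues.
    rcases (hs.iterate n).length_infix_le (K := K1 + K2)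
      (fun a p hp h => (h1 n a p hp h).trans (by omega))
      (fun a p hp h => (h2 n a p hp h).trans (by omega)) hw h with h | ⟨b, h⟩
    · have := Nat.mul_le_mul_right (K1 + K2) (hG ⟨a, rfl⟩)
      simp only at this
      omega
    · exact ih b h

end Dichotomy

/-! ### Linear recurrence of minimal substitution shifts -/

section Main

variable {A : Type*}

/-- The endomorphism `σ` seen as a map on lists. -/
def wordMap (σ : FreeMonoid A →* FreeMonoid A) (w : List A) : List A :=
  FreeMonoid.toList (σ (FreeMonoid.ofList w))

lemma isConcatHom_wordMap (σ : FreeMonoid A →* FreeMonoid A) : IsConcatHom (wordMap σ) := by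
  intro x y
  simp [wordMap, FreeMonoid.ofList_append, FreeMonoid.toList_mul]

lemma toList_iterate (σ : FreeMonoid A →* FreeMonoid A) (n : ℕ) (w : FreeMonoid A) :
    FreeMonoid.toList (σ^[n] w) = (wordMap σ)^[n] (FreeMonoid.toList w) := by
  induction n with
  | zero => rfl
  | succ n ih => simp [Function.iterate_succ_apply', ← ih, wordMap]

lemma mem_morphismLanguage_iff {σ : FreeMonoid A →* FreeMonoid A} {w : List A} :
    w ∈ morphismLanguage σ ↔ ∃ n a, w <:+: (wordMap σ)^[n] [a] := by
  simp [morphismLanguage, toList_iterate]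

lemma mem_morphismLanguage_of_infix {σ : FreeMonoid A →* FreeMonoid A} (u v : List A)
    (h : u <:+: v) (hv : v ∈ morphismLanguage σ) : u ∈ morphismLanguage σ := by
  obtain ⟨n, a, hv⟩ := hv
  exact ⟨n, a, h.trans hv⟩

lemma wordMap_mem_morphismLanguage {σ : FreeMonoid A →* FreeMonoid A} {w : List A}
    (hw : w ∈ morphismLanguage σ) : wordMap σ w ∈ morphismLanguage σ := by
  rw [mem_morphismLanguage_iff] at hw ⊢
  obtain ⟨n, a, h⟩ := hw
  exact ⟨n + 1, a, by
    rw [Function.iterate_succ_apply']; exact (isConcatHom_wordMap σ).map_infix h⟩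

/-- The morphism mapping the only letter of a one-letter alphabet to `q`. -/
def powerMap (q : List A) (z : List Unit) : List A := (List.replicate z.length q).flatten

lemma isConcatHom_powerMap (q : List A) : IsConcatHom (powerMap q) := by
  intro x y
  simp only [powerMap, List.length_append, List.replicate_add, List.flatten_append]

lemma length_powerMap (q : List A) (z : List Unit) :
    (powerMap q z).length = z.length * q.length := by
  simp [powerMap]

lemma prefix_of_length_le_unit {y z : List Unit} (h : y.length ≤ z.length) : y <+: z := by
  have : y = z.take y.length :=
    List.ext_getElem (by simpa using h) fun _ _ _ => rfl
  rw [this]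
  exact List.take_prefix _ _

lemma exists_le_length_iterate {s : List A → List A} {b : A} (hb : ¬ IsBoundedLetter s b)
    (m k : ℕ) : ∃ j, m ≤ j ∧ k ≤ (s^[j] [b]).length := by
  by_contra! hcon
  refine hb ⟨k + ∑ j ∈ Finset.range m, (s^[j] [b]).length, fun j => ?_⟩
  rcases le_or_gt m j with hj | hj
  · have := hcon j hj
    omega
  · have := Finset.single_le_sum (f := fun j => (s^[j] [b]).length) (fun _ _ => Nat.zero_le _)
      (Finset.mem_range.2 hj)
    omega

variable [Finite A] [TopologicalSpace A] [DiscreteTopology A]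
  {σ : FreeMonoid A →* FreeMonoid A}

/-- A minimal substitution shift is linearly recurrent if the language of the morphism contains
all powers of some nonempty word. -/
lemma IsMinimalShift.isLinearlyRecurrent_of_power (hX : IsMinimalShift (substitutionShift σ))
    {q : List A} (hq : q ≠ []) (h : ∀ k, (List.replicate k q).flatten ∈ morphismLanguage σ) :
    IsLinearlyRecurrent (substitutionShift σ) := by
  have hf := isConcatHom_powerMap q
  have hq0 : 0 < q.length := List.length_pos_iff.2 hq
  let F : Set (List A) := {w | ∃ z, w <:+: powerMap q z}
  have hF (u v : List A) (huv : u <:+: v) (hv : v ∈ F) : u ∈ F := by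
    obtain ⟨z, hz⟩ := hv
    exact ⟨z, huv.trans hz⟩
  obtain ⟨x, hx, -⟩ := exists_seqLanguage_subset (F := F) (w := []) hF fun k => by
    have hk : k ≤ (powerMap q (List.replicate k ())).length := by
      rw [length_powerMap, List.length_replicate]
      exact Nat.le_mul_of_pos_right k hq0
    refine ⟨_, _, hk, hk, List.replicate k () ++ List.replicate k (), ?_⟩
    rw [hf, List.append_nil]
  have hxX : x ∈ (substitutionShift σ).carrier := fun w hw => by
    obtain ⟨z, hz⟩ := hx hw
    exact mem_morphismLanguage_of_infix _ _ hz (h _)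
  have hLF (u : List A) (hu : u ∈ shiftLanguage (substitutionShift σ)) : u ∈ F := by
    obtain ⟨R, hR⟩ := hX.exists_recurrence hu
    have hb := block_mem_seqLanguage x 0 R
    exact hF _ _ (hR _ ⟨x, hxX, hb⟩ (length_block _ _ _).ge) (hx hb)
  -- At most `n + 2` copies of `q` cover `u`, and `v` contains at least `5 * n - 2`, which is enough
  -- once `n ≥ 1`.
  refine ⟨5 * q.length, fun n u hu hun v hv hvn => ?_⟩
  rcases Nat.eq_zero_or_pos n with rfl | hn
  · rw [List.length_eq_zero_iff.1 hun]
    exact List.nil_infix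
  obtain ⟨y, hy⟩ := hLF u hu
  obtain ⟨z, hz⟩ := hLF v hv
  obtain ⟨y', -, huy, hy'⟩ := hf.exists_cover hy
  have hylen : y'.length ≤ n + 2 := by
    rcases hy' with hy' | ⟨c, y'', d, rfl, hy'⟩
    · omega
    · have h1 := hy'.length_le
      rw [length_powerMap, hun] at h1
      have := Nat.le_mul_of_pos_right y''.length hq0
      simp only [List.length_append, List.length_singleton]
      omega
  obtain ⟨z', -, hzv, hlen⟩ := hf.exists_map_infix hz (M := q.length)
    (fun a _ => by simp [length_powerMap])
  have h5 : 5 * n ≤ z'.length + 2 := by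
    rw [hvn] at hlen
    refine Nat.le_of_mul_le_mul_right ?_ hq0
    calc 5 * n * q.length = 5 * q.length * n := by ring
      _ ≤ _ := hlen
  exact huy.trans ((hf.map_prefix (prefix_of_length_le_unit (by omega))).isInfix.trans hzv)

/-- The language of a minimal substitution shift is invariant under the morphism if it contains
an unbounded letter. -/
lemma IsMinimalShift.wordMap_mem_shiftLanguage (hX : IsMinimalShift (substitutionShift σ)) {b : A}
    (hb : ¬ IsBoundedLetter (wordMap σ) b) (hbX : [b] ∈ shiftLanguage (substitutionShift σ))
    {w : List A} (hw : w ∈ shiftLanguage (substitutionShift σ)) :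
    wordMap σ w ∈ shiftLanguage (substitutionShift σ) := by
  have hs := isConcatHom_wordMap σ
  obtain ⟨R, hR⟩ := hX.exists_recurrence hbX
  have hb1 : 1 ≤ (wordMap σ [b]).length := by
    by_contra! h0
    obtain ⟨j, hj, hjk⟩ := exists_le_length_iterate hb 1 1
    obtain ⟨i, rfl⟩ := Nat.exists_eq_add_of_le' hj
    rw [Function.iterate_succ_apply, List.length_eq_zero_iff.1 (Nat.lt_one_iff.1 h0),
      (hs.iterate i).map_nil] at hjk
    simp at hjk
  -- Each block of length `R` contains `b`, whose image is nonempty, so erasing cannot keep images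
  -- of long words short.
  have hlong (k : ℕ) : ∀ u ∈ shiftLanguage (substitutionShift σ), u.length = k * R →
      k ≤ (wordMap σ u).length := by
    induction k with
    | zero => simp
    | succ k ih =>
      intro u hu hlen
      rw [Nat.succ_mul] at hlen
      have h1 := ih (u.drop R)
        (mem_shiftLanguage_of_infix (List.drop_suffix _ _).isInfix hu) (by simp; omega)
      have h2 := (hs.map_infix (hR (u.take R)
        (mem_shiftLanguage_of_infix (List.take_prefix _ _).isInfix hu) (by simp; omega))).length_le
      rw [← List.take_append_drop R u, hs, List.length_append]
      omega
  obtain ⟨x, hx, hwx⟩ := exists_seqLanguage_subset (F := morphismLanguage σ) (w := wordMap σ w)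
    mem_morphismLanguage_of_infix fun k => by
      obtain ⟨u, v, hu, hv, huv⟩ := exists_extension_mem_shiftLanguage hw (k * R)
      refine ⟨wordMap σ u, wordMap σ v, hlong k u ?_ hu, hlong k v ?_ hv, ?_⟩
      · exact mem_shiftLanguage_of_infix ⟨[], w ++ v, by simp⟩ huv
      · exact mem_shiftLanguage_of_infix ⟨u ++ w, [], by simp⟩ huv
      · rw [← hs, ← hs]
        exact wordMap_mem_morphismLanguage (shiftLanguage_subset_morphismLanguage huv)
  exact ⟨x, hx, hwx⟩

/-- A minimal substitution shift is linearly recurrent if an unbounded letter occurs in it. -/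
lemma IsMinimalShift.isLinearlyRecurrent_of_unbounded (hX : IsMinimalShift (substitutionShift σ))
    {b : A} (hb : ¬ IsBoundedLetter (wordMap σ) b)
    (hbX : [b] ∈ shiftLanguage (substitutionShift σ)) :
    IsLinearlyRecurrent (substitutionShift σ) := by
  set L := shiftLanguage (substitutionShift σ) with hL
  have hs := isConcatHom_wordMap σ
  set s := wordMap σ
  have hmap (m : ℕ) {w : List A} (hw : w ∈ L) : s^[m] w ∈ L := by
    induction m with
    | zero => exact hw
    | succ m ih =>
      rw [Function.iterate_succ_apply']
      exact hX.wordMap_mem_shiftLanguage hb hbX ih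
  obtain ⟨R₁, hR₁⟩ := hX.exists_recurrence hbX
  obtain ⟨R, hR⟩ := hX.exists_uniform_recurrence (R₁ + 2)
  obtain ⟨k, -, hk⟩ := exists_le_length_iterate hb 0 R
  obtain ⟨C, hC⟩ := (Set.finite_range fun a : A => (s^[k] [a]).length).bddAbove
  obtain ⟨G, hG⟩ := (Set.finite_range fun a : A => (s [a]).length).bddAbove
  -- The letter `a` occurs in `s^[k] [b]`, and `s^[m + k] [b]` is also the `k`-th image of `s^[m]
  -- [b]`.
  have hcomp (m : ℕ) (a : A) (ha : [a] ∈ L) :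
      (s^[m] [a]).length ≤ (s^[m] [b]).length * C := by
    have h1 := ((hs.iterate m).map_infix (hR [a] ha (by simp) _ (hmap k hbX) hk)).length_le
    rw [← Function.iterate_add_apply, add_comm, Function.iterate_add_apply] at h1
    exact h1.trans ((hs.iterate k).length_map_le fun c _ => hC ⟨c, rfl⟩)
  have hanc (m : ℕ) (u : List A) (hu : u ∈ L) : ∃ w ∈ L, u <:+: s^[m] w := by
    obtain ⟨Ru, hRu⟩ := hX.exists_recurrence hu
    obtain ⟨j, hj, hju⟩ := exists_le_length_iterate hb m Ru
    obtain ⟨i, rfl⟩ := Nat.exists_eq_add_of_le hj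
    refine ⟨s^[i] [b], hmap i hbX, ?_⟩
    rw [← Function.iterate_add_apply]
    exact hRu _ (hmap _ hbX) hju
  refine ⟨(R + 2) * ((C + 1) * (G + 1)), fun n u hu hun v hv hvn => ?_⟩
  rcases Nat.eq_zero_or_pos n with rfl | hn
  · rw [List.length_eq_zero_iff.1 hun]
    exact List.nil_infix
  -- For the least `m` exceeding `n`, the preceding length is at most `n` and one step multiplies it
  -- by at most `G`.
  obtain ⟨m, hm1, hm2⟩ : ∃ m, n < (s^[m] [b]).length ∧ (s^[m] [b]).length ≤ (G + 1) * n := by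
    classical
    have hex : ∃ m, n < (s^[m] [b]).length := by
      obtain ⟨m, -, hm⟩ := exists_le_length_iterate hb 0 (n + 1)
      exact ⟨m, hm⟩
    refine ⟨Nat.find hex, Nat.find_spec hex, ?_⟩
    rcases h : Nat.find hex with _ | j
    · exact Nat.mul_pos G.succ_pos hn
    · have h1 := not_lt.1 (Nat.find_min hex (m := j) (by omega))
      rw [Function.iterate_succ_apply']
      have h2 := hs.length_map_le (w := s^[j] [b]) (M := G) fun c _ => hG ⟨c, rfl⟩
      nlinarith
  obtain ⟨w, hw, huw⟩ := hanc m u hu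
  obtain ⟨w', hw', huw', hcov⟩ := (hs.iterate m).exists_cover huw
  have hw'L : w' ∈ L := mem_shiftLanguage_of_infix hw' hw
  have hlen : w'.length ≤ R₁ + 2 := by
    rcases hcov with hcov | ⟨c, w'', d, rfl, hcov⟩
    · omega
    -- A longer interior would contain `b`, and its image inside `u` would have more than `n`
    -- letters.
    · by_contra! hlt
      simp only [List.length_append, List.length_singleton] at hlt
      have h1 := hR₁ w'' (mem_shiftLanguage_of_infix ⟨[c], [d], rfl⟩ hw'L) (by omega)
      have h2 := ((hs.iterate m).map_infix h1).length_le
      have h3 := hcov.length_le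
      omega
  obtain ⟨z, hz, hvz⟩ := hanc m v hv
  obtain ⟨z', hz', hzv, hvlen⟩ := (hs.iterate m).exists_map_infix hvz
    (M := (C + 1) * ((G + 1) * n)) fun a ha => by
      have h1 := hcomp m a (mem_shiftLanguage_of_infix (by
        obtain ⟨p, r, rfl⟩ := List.append_of_mem ha
        exact ⟨p, r, by simp⟩) hz)
      calc _ ≤ _ := h1
        _ ≤ ((G + 1) * n) * (C + 1) := Nat.mul_le_mul hm2 (Nat.le_succ C)
        _ = _ := mul_comm _ _
  have hRz : R ≤ z'.length := by
    rw [hvn] at hvlen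
    have : R + 2 ≤ z'.length + 2 := by
      refine Nat.le_of_mul_le_mul_right (c := (C + 1) * ((G + 1) * n)) ?_ (by positivity)
      calc _ = _ := by ring
        _ ≤ _ := hvlen
    omega
  have h1 := hR w' hw'L hlen z' (mem_shiftLanguage_of_infix hz' hz) hRz
  exact huw'.trans (((hs.iterate m).map_infix h1).trans hzv)

/-- A minimal substitution shift is linearly recurrent. -/
lemma IsMinimalShift.isLinearlyRecurrent (hX : IsMinimalShift (substitutionShift σ)) :
    IsLinearlyRecurrent (substitutionShift σ) := by
  by_cases h : ∃ b, [b] ∈ shiftLanguage (substitutionShift σ) ∧ ¬ IsBoundedLetter (wordMap σ) b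
  · obtain ⟨b, hbX, hb⟩ := h
    exact hX.isLinearlyRecurrent_of_unbounded hb hbX
  push Not at h
  rcases exists_run_bound_or_power (isConcatHom_wordMap σ) with ⟨K, hK⟩ | ⟨q, hq, hpow⟩
  · exfalso
    obtain ⟨w, hw, hlen⟩ := exists_mem_shiftLanguage_length hX.1 (K + 1)
    obtain ⟨n, a, hna⟩ := mem_morphismLanguage_iff.1 (shiftLanguage_subset_morphismLanguage hw)
    have := hK n a w (fun c hc => h c (mem_shiftLanguage_of_infix (by
      obtain ⟨p, r, rfl⟩ := List.append_of_mem hc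
      exact ⟨p, r, by simp⟩) hw)) hna
    omega
  · exact hX.isLinearlyRecurrent_of_power hq fun k => mem_morphismLanguage_iff.2 (hpow k)

end Main

end SubstitutionShift

theorem mainTheorem6 {A : Type*} [Finite A] [TopologicalSpace A] [DiscreteTopology A]
    (σ : FreeMonoid A →* FreeMonoid A)
    (hne : (SubstitutionShift.substitutionShift σ).carrier.Nonempty) :
    SubstitutionShift.IsMinimalShift (SubstitutionShift.substitutionShift σ) ↔
      SubstitutionShift.IsLinearlyRecurrent (SubstitutionShift.substitutionShift σ) :=
  ⟨fun h => h.isLinearlyRecurrent, fun h => h.isMinimalShift hne⟩
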